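/- Let $d\ge 1$ and let $X_n=(\xi_n,Y_n)$, $n\ge 0$, be the Markov chain on the half-strip $S=\{0,1,2,\dots\}\times\{1,\dots,d\}$, with layers $L_n=\{n\}\times\{1,\dots,d\}$, which from layer $n\ge1$ moves to layer $n+1$, $n-1$, $n$ according to the nonnegative $d\times d$ matrices $P_n$, $Q_n$, $R_n$ respectively (so $(P_n+Q_n+R_n)\mathbf 1=\mathbf 1$, where $\mathbf 1$ is the column vector of ones), and from layer $0$ moves to layer $1$ according to a stochastic $d\times d$ matrix $P_0$. Assume: ($C_1$) for every $n\ge1$, $\log(1-\|R_n+P_n\|)^{-1}<\infty$ and $\log(1-\|R_n+Q_n\|)^{-1}<\infty$, that is, $\|R_n+P_n\|<1$ and $\|R_n+Q_n\|<1$, where $\|\cdot\|$ is the maximal absolute row sum; ($C_2$) for every $j$, $\sum_{i}P_n(i,j)>0$ for all $n\ge0$ and $\sum_{i}Q_n(i,j)>0$ for all $n\ge1$; ($C_3$) any two sites of layer $0$ communicate. Call layer $y$ recurrent if, from every site of $L_y$, the walk returns to $L_y$ at some positive time with probability $1$, and call the walk recurrent if all its layers are recurrent. Define $$\zeta_0^+=P_0,\qquad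 \zeta_n^+=(I-Q_n\zeta_{n-1}^+-R_n)^{-1}P_n,\qquad A_n^+=(I-Q_n\zeta_{n-1}^+-R_n)^{-1}Q_n\qquad(n\ge1).$$ For a probability (row) vector $\mu$ on $\{1,\dots,d\}$, regarded as the initial distribution of the walk on layer $0$, define $$\beta^+=\sum_{k=0}^{\infty}\mu_kA_k^+A_{k-1}^+\cdots A_1^+\mathbf 1,\qquad \mu_k=\mu\,\zeta_0^+\zeta_1^+\cdots\zeta_{k-1}^+ ,$$ where empty products are $I$. Then all the inverse matrices above exist, all the terms of the series are nonnegative, and the random walk is recurrent if and only if $\beta^+=\infty$. -/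

import Mathlib

open MeasureTheory ProbabilityTheory
open scoped ENNReal Matrix

/-- The blocks of the transition matrix of a reflecting, state-dependent random walk on the
half-strip `{0, 1, 2, …} × {1, …, d}` (the set `{1, …, d}` is `Fin d`).  From layer `n ≥ 1` the
walk moves to layer `n + 1`, `n - 1`, `n` according to `P n`, `Q n`, `R n`; from layer `0` it moves
to layer `1` according to `P 0`.  The values `Q 0` and `R 0` play no role. -/
structure HalfStripWalk (d : ℕ) where
  P : ℕ → Matrix (Fin d) (Fin d) ℝ
  Q : ℕ → Matrix (Fin d) (Fin d) ℝ
  R : ℕ → Matrix (Fin d) (Fin d) ℝ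
  P_nonneg : ∀ n i j, 0 ≤ P n i j
  Q_nonneg : ∀ n, 1 ≤ n → ∀ i j, 0 ≤ Q n i j
  R_nonneg : ∀ n, 1 ≤ n → ∀ i j, 0 ≤ R n i j
  P_zero_stochastic : P 0 *ᵥ 1 = 1
  row_sum : ∀ n, 1 ≤ n → (P n + Q n + R n) *ᵥ 1 = 1

namespace HalfStripWalk

variable {d : ℕ} (W : HalfStripWalk d)

/-- The one-step transition probability from the site `x` to the site `y`. -/
def trans : ℕ × Fin d → ℕ × Fin d → ℝ
  | (0, i), (m, j) => if m = 1 then W.P 0 i j else 0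
  | (n + 1, i), (m, j) =>
      if m = n + 2 then W.P (n + 1) i j
      else if m = n + 1 then W.R (n + 1) i j
      else if m = n then W.Q (n + 1) i j
      else 0

theorem trans_nonneg (x y : ℕ × Fin d) : 0 ≤ W.trans x y := by
  obtain ⟨n, i⟩ := x
  obtain ⟨m, j⟩ := y
  cases n with
  | zero =>
    simp only [trans]
    split_ifs
    exacts [W.P_nonneg _ _ _, le_rfl]
  | succ n =>
    simp only [trans]
    split_ifs
    exacts [W.P_nonneg _ _ _, W.R_nonneg _ (by omega) _ _, W.Q_nonneg _ (by omega) _ _, le_rfl]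

theorem tsum_trans (x : ℕ × Fin d) : ∑' y, ENNReal.ofReal (W.trans x y) = 1 := by
  obtain ⟨n, i⟩ := x
  rw [ENNReal.tsum_prod']
  simp_rw [tsum_fintype]
  cases n with
  | zero =>
    rw [tsum_eq_single 1 (by intro m hm; simp [trans, hm])]
    rw [← ENNReal.ofReal_sum_of_nonneg (fun j _ => W.trans_nonneg _ _)]
    have h := congrFun W.P_zero_stochastic i
    simp only [Matrix.mulVec, dotProduct, Pi.one_apply, mul_one] at h
    simp [trans, h]
  | succ n =>
    rw [tsum_eq_sum (s := {n + 2, n + 1, n}) (by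
      intro m hm
      simp only [Finset.mem_insert, Finset.mem_singleton, not_or] at hm
      simp [trans, hm])]
    rw [Finset.sum_insert (by simp), Finset.sum_insert (by simp), Finset.sum_singleton]
    rw [← Finset.sum_add_distrib, ← Finset.sum_add_distrib]
    have h := congrFun (W.row_sum (n + 1) (by omega)) i
    simp only [Matrix.mulVec, dotProduct, Pi.one_apply, mul_one, Matrix.add_apply] at h
    rw [← ENNReal.ofReal_one, ← h, ENNReal.ofReal_sum_of_nonneg]
    · refine Finset.sum_congr rfl fun j _ => ?_
      have hP := W.P_nonneg (n + 1) i j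
      have hQ := W.Q_nonneg (n + 1) (by omega) i j
      have hR := W.R_nonneg (n + 1) (by omega) i j
      simp only [trans, if_true, Nat.succ_ne_self, if_false,
        show ¬ (n + 1 = n + 2) by omega, show ¬ (n = n + 2) by omega,
        show ¬ (n = n + 1) by omega]
      rw [← ENNReal.ofReal_add hR hQ, ← ENNReal.ofReal_add hP (add_nonneg hR hQ)]
      congr 1
      ring
    · intro j _
      have hP := W.P_nonneg (n + 1) i j
      have hQ := W.Q_nonneg (n + 1) (by omega) i j
      have hR := W.R_nonneg (n + 1) (by omega) i j
      positivity

/-- The law of the position after one step from `x`. -/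
noncomputable def step (x : ℕ × Fin d) : PMF (ℕ × Fin d) :=
  ⟨fun y => ENNReal.ofReal (W.trans x y), ENNReal.summable.hasSum_iff.2 (W.tsum_trans x)⟩

/-- The conditional law of the position at time `n + 1` given the positions at times `0, …, n`. -/
noncomputable def stepKernel (n : ℕ) :
    Kernel (Π _ : Finset.Iic n, ℕ × Fin d) (ℕ × Fin d) where
  toFun h := (W.step (h ⟨n, Finset.mem_Iic.2 le_rfl⟩)).toMeasure
  measurable' :=
    (measurable_from_top (f := fun x : ℕ × Fin d => (W.step x).toMeasure)).comp
      ((measurable_pi_apply (⟨n, Finset.mem_Iic.2 le_rfl⟩ : Finset.Iic n)).mono le_rfl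
        (fun _ _ => (Set.to_countable _).measurableSet))

instance (n : ℕ) : IsMarkovKernel (W.stepKernel n) :=
  ⟨fun h => PMF.toMeasure.isProbabilityMeasure (W.step (h ⟨n, Finset.mem_Iic.2 le_rfl⟩))⟩

/-- `P_x`: the law, on the space of paths, of the random walk started at the site `x`.  The
position at time `n` is the coordinate `ω n`. -/
noncomputable def law (x : ℕ × Fin d) : Measure (ℕ → ℕ × Fin d) :=
  Kernel.traj (X := fun _ => ℕ × Fin d) W.stepKernel 0 (fun _ => x)

/-- `f_{x,y}^{(n)}`: the probability, for the walk started at the site `x`, that the first visit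
at a positive time to layer `y` takes place at time `n`. -/
noncomputable def firstHitProb (x : ℕ × Fin d) (y n : ℕ) : ℝ≥0∞ :=
  W.law x {ω | (ω n).1 = y ∧ ∀ m, 1 ≤ m → m < n → (ω m).1 ≠ y}

/-- `f_{x,y} = ∑_{n ≥ 1} f_{x,y}^{(n)}`: the probability that the walk started at the site `x`
visits layer `y` at some positive time. -/
noncomputable def hitProb (x : ℕ × Fin d) (y : ℕ) : ℝ≥0∞ :=
  ∑' n : ℕ, W.firstHitProb x y (n + 1)

/-- Layer `y` is recurrent: from every site of the layer, the walk returns to the layer almost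
surely. -/
def LayerRecurrent (y : ℕ) : Prop :=
  ∀ i : Fin d, W.hitProb (y, i) y = 1

/-- The random walk is recurrent: all its layers are recurrent. -/
def Recurrent : Prop :=
  ∀ y : ℕ, W.LayerRecurrent y

section Conditions

attribute [local instance] Matrix.linftyOpNormedAddCommGroup

/-- The standing conditions on the walk.  The norm is the maximal absolute row sum, the operator
norm for the sup norm on column vectors; `log (1 - ‖M‖)⁻¹ < ∞` means that `‖M‖ < 1`. -/
structure ConditionC : Prop where
  norm_up : ∀ n, 1 ≤ n → ‖W.R n + W.P n‖ < 1
  norm_down : ∀ n, 1 ≤ n → ‖W.R n + W.Q n‖ < 1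
  col_P : ∀ n j, 0 < ∑ i, W.P n i j
  col_Q : ∀ n, 1 ≤ n → ∀ j, 0 < ∑ i, W.Q n i j
  layer_zero_communicates : ∀ i j : Fin d,
    Relation.ReflTransGen (fun x y => 0 < W.trans x y) (0, i) (0, j)

end Conditions

/-- The exit probability matrices `ζ_0⁺ = P_0`, `ζ_n⁺ = (I - Q_n ζ_{n-1}⁺ - R_n)⁻¹ P_n`. -/
noncomputable def zetaPlus : ℕ → Matrix (Fin d) (Fin d) ℝ
  | 0 => W.P 0
  | n + 1 => (1 - W.Q (n + 1) * zetaPlus n - W.R (n + 1))⁻¹ * W.P (n + 1)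

/-- The mean offspring matrices `A_n⁺ = (I - Q_n ζ_{n-1}⁺ - R_n)⁻¹ Q_n`, used for `n ≥ 1` only. -/
noncomputable def APlus (n : ℕ) : Matrix (Fin d) (Fin d) ℝ :=
  (1 - W.Q n * W.zetaPlus (n - 1) - W.R n)⁻¹ * W.Q n

/-- The product `A_k⁺ A_{k-1}⁺ ⋯ A_1⁺`. -/
noncomputable def APlusProd : ℕ → Matrix (Fin d) (Fin d) ℝ
  | 0 => 1
  | k + 1 => W.APlus (k + 1) * APlusProd k

/-- The row vector `μ_k = μ ζ_0⁺ ζ_1⁺ ⋯ ζ_{k-1}⁺`. -/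
noncomputable def muLayer (μ : Fin d → ℝ) : ℕ → Fin d → ℝ
  | 0 => μ
  | k + 1 => muLayer μ k ᵥ* W.zetaPlus k

/-- The number `μ_k A_k⁺ A_{k-1}⁺ ⋯ A_1⁺ 𝟏`. -/
noncomputable def betaTerm (μ : Fin d → ℝ) (k : ℕ) : ℝ :=
  (W.muLayer μ k ᵥ* W.APlusProd k) ⬝ᵥ 1

/-- `β⁺ = ∑_{k ≥ 0} μ_k A_k⁺ A_{k-1}⁺ ⋯ A_1⁺ 𝟏`, a series of nonnegative numbers. -/
noncomputable def betaPlus (μ : Fin d → ℝ) : ℝ≥0∞ :=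
  ∑' k : ℕ, ENNReal.ofReal (W.betaTerm μ k)

end HalfStripWalk

/-! The series `betaPlus` is the expected number of visits to layer `0` for initial law `μ`, split
at the first visits to the successive layers (`betaPlus_eq`). Write `G` for the corresponding
function `visits` of the starting site; it solves `G = 1 + TG` on layer `0` and `G = TG` elsewhere,
where `T` is `expectStep`. If layer `0` is recurrent, the minimum `c` of `G` on that layer satisfies
`1 + c ≤ c`, so `G = ⊤` there (`visits_eq_top`). If some layer is not recurrent, its hitting
probability, set to `1` on the layer, is bounded and superharmonic, with a positive defect at some
site. Applying `T` along paths carries such a defect back to every site of layer `0`. A finite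
weighted sum is then a finite superharmonic function with defect at least `1` on layer `0`, and `G`
lies below every such function (`visits_le`), hence is finite. -/

namespace HalfStripWalk

variable {d : ℕ} (W : HalfStripWalk d)

/-! ### One-step expectations and hitting probabilities -/

/-- The expectation of `f` after one step from `x`. -/
noncomputable def expectStep (f : ℕ × Fin d → ℝ≥0∞) (x : ℕ × Fin d) : ℝ≥0∞ :=
  ∑' z, ENNReal.ofReal (W.trans x z) * f z

theorem expectStep_mono {f g : ℕ × Fin d → ℝ≥0∞} (h : ∀ z, f z ≤ g z) (x : ℕ × Fin d) :
    W.expectStep f x ≤ W.expectStep g x :=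
  ENNReal.tsum_le_tsum fun z => mul_le_mul_right (h z) _

theorem expectStep_add (f g : ℕ × Fin d → ℝ≥0∞) (x : ℕ × Fin d) :
    W.expectStep (fun z => f z + g z) x = W.expectStep f x + W.expectStep g x := by
  simp only [expectStep, mul_add, ENNReal.tsum_add]

theorem expectStep_const_mul (c : ℝ≥0∞) (f : ℕ × Fin d → ℝ≥0∞) (x : ℕ × Fin d) :
    W.expectStep (fun z => c * f z) x = c * W.expectStep f x := by
  simp only [expectStep, ← ENNReal.tsum_mul_left]
  exact tsum_congr fun z => mul_left_comm _ _ _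

theorem expectStep_tsum {ι : Type*} (f : ι → ℕ × Fin d → ℝ≥0∞) (x : ℕ × Fin d) :
    W.expectStep (fun z => ∑' n, f n z) x = ∑' n, W.expectStep (f n) x := by
  simp only [expectStep, ← ENNReal.tsum_mul_left]
  exact ENNReal.tsum_comm

theorem expectStep_const (c : ℝ≥0∞) (x : ℕ × Fin d) : W.expectStep (fun _ => c) x = c := by
  simp only [expectStep, ENNReal.tsum_mul_right, W.tsum_trans, one_mul]

theorem expectStep_zero (f : ℕ × Fin d → ℝ≥0∞) (i : Fin d) :
    W.expectStep f (0, i) = ∑ j, ENNReal.ofReal (W.P 0 i j) * f (1, j) := by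
  rw [expectStep, ENNReal.tsum_prod', tsum_eq_single 1 (by intro m hm; simp [trans, hm])]
  simp [trans, tsum_fintype]

theorem expectStep_succ (f : ℕ × Fin d → ℝ≥0∞) (n : ℕ) (i : Fin d) :
    W.expectStep f (n + 1, i) = ∑ j, ENNReal.ofReal (W.P (n + 1) i j) * f (n + 2, j) +
      (∑ j, ENNReal.ofReal (W.R (n + 1) i j) * f (n + 1, j) +
        ∑ j, ENNReal.ofReal (W.Q (n + 1) i j) * f (n, j)) := by
  rw [expectStep, ENNReal.tsum_prod', tsum_eq_sum (s := {n + 2, n + 1, n}) (by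
      intro m hm
      simp only [Finset.mem_insert, Finset.mem_singleton, not_or] at hm
      simp [trans, hm])]
  rw [Finset.sum_insert (by simp), Finset.sum_insert (by simp), Finset.sum_singleton]
  simp [trans, tsum_fintype]

theorem expectStep_eq_lintegral (f : ℕ × Fin d → ℝ≥0∞) (x : ℕ × Fin d) :
    W.expectStep f x = ∫⁻ z, f z ∂(W.step x).toMeasure := by
  rw [lintegral_countable', expectStep]
  refine tsum_congr fun z => ?_
  rw [PMF.toMeasure_apply_singleton _ _ (measurableSet_singleton _), mul_comm]
  rfl

/-- The function which vanishes on layer `y` and agrees with `f` elsewhere. -/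
def offLayer (y : ℕ) (f : ℕ × Fin d → ℝ≥0∞) (z : ℕ × Fin d) : ℝ≥0∞ :=
  if z.1 = y then 0 else f z

instance (x : ℕ × Fin d) : IsProbabilityMeasure (W.law x) := by
  unfold law; infer_instance

/-- The Markov property: the joint law of the history up to time `n` and the next position is a
composition-product with `stepKernel n`, so the last step integrates out. -/
theorem lintegral_law_succ (x : ℕ × Fin d) (n : ℕ)
    (φ : (Π _ : Finset.Iic n, ℕ × Fin d) → ℝ≥0∞) (f : ℕ × Fin d → ℝ≥0∞) :
    ∫⁻ ω, φ (Preorder.frestrictLe n ω) * f (ω (n + 1)) ∂W.law x =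
      ∫⁻ ω, φ (Preorder.frestrictLe n ω) * W.expectStep f (ω n) ∂W.law x := by
  have hφ : Measurable φ := measurable_of_countable φ
  have hf : Measurable f := measurable_of_countable f
  have h := Kernel.partialTraj_compProd_eq_map_traj (X := fun _ => ℕ × Fin d) (κ := W.stepKernel) (Nat.zero_le n)
    (x₀ := fun _ => x)
  have h1 : ∫⁻ ω, φ (Preorder.frestrictLe n ω) * f (ω (n + 1)) ∂W.law x =
      ∫⁻ p, φ p.1 * f p.2 ∂((W.law x).map
        (fun ω => (Preorder.frestrictLe (π := fun _ => ℕ × Fin d) n ω, ω (n + 1)))) := by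
    rw [lintegral_map (by fun_prop) (by fun_prop)]
  rw [h1, law]
  rw [← h, Measure.lintegral_compProd (by fun_prop), ← Kernel.traj_map_frestrictLe_apply,
    lintegral_map (by exact measurable_of_countable _) (by fun_prop)]
  refine lintegral_congr fun ω => ?_
  dsimp only
  rw [lintegral_const_mul _ hf, expectStep_eq_lintegral]
  rfl

theorem law_apply_zero (x : ℕ × Fin d) : ∀ᵐ ω ∂W.law x, ω 0 = x := by
  have h := Kernel.traj_map_frestrictLe_of_le (X := fun _ => ℕ × Fin d) (κ := W.stepKernel) (le_refl 0)
  have h1 : (W.law x).map (Preorder.frestrictLe (π := fun _ => ℕ × Fin d) 0) =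
      Measure.dirac (fun _ => x) := by
    rw [law, ← Kernel.map_apply _ (by fun_prop), h, Kernel.deterministic_apply]
    rfl
  have h2 : ∀ᵐ p ∂((W.law x).map (Preorder.frestrictLe (π := fun _ => ℕ × Fin d) 0)),
      p ⟨0, Finset.mem_Iic.2 le_rfl⟩ = x := by
    rw [h1, ae_dirac_iff (Set.to_countable _).measurableSet]
  exact ae_of_ae_map (by fun_prop) h2

/-- The indicator of the event that the walk avoids layer `y` at the times `1, …, n`. -/
noncomputable def avoids (y n : ℕ) : (ℕ → ℕ × Fin d) → ℝ≥0∞ :=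
  Set.indicator {ω | ∀ m, 1 ≤ m → m < n + 1 → (ω m).1 ≠ y} 1

theorem avoids_zero (y : ℕ) (ω : ℕ → ℕ × Fin d) : avoids y 0 ω = 1 :=
  Set.indicator_of_mem (fun m h1 h2 => by omega) 1

theorem avoids_succ (y n : ℕ) (ω : ℕ → ℕ × Fin d) (f : ℕ × Fin d → ℝ≥0∞) :
    avoids y (n + 1) ω * f (ω (n + 1)) = avoids y n ω * offLayer y f (ω (n + 1)) := by
  unfold avoids offLayer
  by_cases h : (ω (n + 1)).1 = y
  · have h' : ω ∉ {ω : ℕ → ℕ × Fin d | ∀ m, 1 ≤ m → m < n + 1 + 1 → (ω m).1 ≠ y} :=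
      fun h' => h' (n + 1) (by omega) (by omega) h
    rw [Set.indicator_of_notMem h', if_pos h]
    simp
  · rw [if_neg h]
    congr 1
    refine Set.indicator_eq_indicator ⟨fun h' m h1 h2 => h' m h1 (by omega), fun h' m h1 h2 => ?_⟩
      rfl
    rcases Nat.lt_succ_iff_lt_or_eq.1 h2 with h3 | rfl
    · exact h' m h1 h3
    · exact h

theorem lintegral_avoids_succ (x : ℕ × Fin d) (y n : ℕ) (f : ℕ × Fin d → ℝ≥0∞) :
    ∫⁻ ω, avoids y n ω * f (ω (n + 1)) ∂W.law x =
      ∫⁻ ω, avoids y n ω * W.expectStep f (ω n) ∂W.law x := by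
  have h := W.lintegral_law_succ x n
    (Set.indicator {p | ∀ m : Finset.Iic n, 1 ≤ m.1 → (p m).1 ≠ y} 1) f
  have key : ∀ ω : ℕ → ℕ × Fin d, avoids y n ω =
      Set.indicator {p : Finset.Iic n → ℕ × Fin d | ∀ m, 1 ≤ m.1 → (p m).1 ≠ y} 1
        (Preorder.frestrictLe (π := fun _ => ℕ × Fin d) n ω) := by
    intro ω
    refine Set.indicator_eq_indicator ⟨fun h m hm => ?_, fun h m hm hn => ?_⟩ rfl
    · exact h m.1 hm (Nat.lt_succ_of_le (Finset.mem_Iic.1 m.2))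
    · exact h ⟨m, Finset.mem_Iic.2 (Nat.le_of_lt_succ hn)⟩ hm
  simp only [key]
  exact h

/-- Integrating out the last step and absorbing the avoidance at time `n` into the test function
shortens the path by one. The outermost `expectStep` carries no `offLayer`, since time `0` is
unconstrained. -/
theorem lintegral_avoids (x : ℕ × Fin d) (y n : ℕ) (f : ℕ × Fin d → ℝ≥0∞) :
    ∫⁻ ω, avoids y n ω * f (ω (n + 1)) ∂W.law x =
      W.expectStep ((fun g => offLayer y (W.expectStep g))^[n] f) x := by
  induction n generalizing f with
  | zero =>
    rw [lintegral_avoids_succ]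
    have h : ∀ᵐ ω ∂W.law x, avoids y 0 ω * W.expectStep f (ω 0) = W.expectStep f x := by
      filter_upwards [W.law_apply_zero x] with ω hω
      rw [hω, avoids_zero, one_mul]
    rw [lintegral_congr_ae h]
    simp
  | succ n ih =>
    rw [lintegral_avoids_succ, Function.iterate_succ_apply, ← ih]
    exact lintegral_congr fun ω => avoids_succ y n ω _

theorem firstHitProb_eq_iterate (x : ℕ × Fin d) (y n : ℕ) :
    W.firstHitProb x y (n + 1) =
      W.expectStep ((fun g => offLayer y (W.expectStep g))^[n]
        (fun z => if z.1 = y then 1 else 0)) x := by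
  rw [← lintegral_avoids, firstHitProb]
  have hm : MeasurableSet {ω : ℕ → ℕ × Fin d |
      (ω (n + 1)).1 = y ∧ ∀ m, 1 ≤ m → m < n + 1 → (ω m).1 ≠ y} := by
    measurability
  rw [← lintegral_indicator_one hm]
  refine lintegral_congr fun ω => ?_
  by_cases h1 : (ω (n + 1)).1 = y
  · rw [if_pos h1, mul_one]
    exact Set.indicator_eq_indicator ⟨fun h => h.2, fun h => ⟨h1, h⟩⟩ rfl
  · rw [if_neg h1, mul_zero]
    exact Set.indicator_of_notMem (fun h => h1 h.1) _

theorem firstHitProb_one (x : ℕ × Fin d) (y : ℕ) :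
    W.firstHitProb x y 1 = W.expectStep (fun z => if z.1 = y then 1 else 0) x :=
  W.firstHitProb_eq_iterate x y 0

/-- First-step analysis without a shift on path space: the iterate, built from the last step
inwards, is peeled at its outer end. -/
theorem firstHitProb_succ_succ (x : ℕ × Fin d) (y n : ℕ) :
    W.firstHitProb x y (n + 2) =
      W.expectStep (offLayer y fun z => W.firstHitProb z y (n + 1)) x := by
  rw [firstHitProb_eq_iterate, Function.iterate_succ_apply']
  congr 2
  funext z
  rw [firstHitProb_eq_iterate]

theorem hitProb_eq_expectStep (x : ℕ × Fin d) (y : ℕ) :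
    W.hitProb x y = W.expectStep (fun z => if z.1 = y then 1 else W.hitProb z y) x := by
  conv_lhs => rw [hitProb, tsum_eq_zero_add' ENNReal.summable]
  simp only [zero_add, firstHitProb_one, firstHitProb_succ_succ]
  rw [← expectStep_tsum, ← expectStep_add]
  congr 1
  funext z
  unfold offLayer
  split_ifs <;> simp [hitProb]

/-- Optional stopping in analytic form: partial sums of the hitting series are compared with `u` by
induction on the number of terms, uniformly in the starting site. -/
theorem mul_hitProb_le {u : ℕ × Fin d → ℝ≥0∞} {y : ℕ} {c : ℝ≥0∞}
    (h : ∀ x, W.expectStep (fun z => if z.1 = y then c else u z) x ≤ u x) (x : ℕ × Fin d) :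
    c * W.hitProb x y ≤ u x := by
  rw [hitProb, ← ENNReal.tsum_mul_left]
  refine ENNReal.tsum_le_of_sum_range_le fun N => ?_
  induction N generalizing x with
  | zero => simp
  | succ N ih =>
    refine le_trans ?_ (h x)
    rw [Finset.sum_range_succ']
    simp only [zero_add, firstHitProb_one, firstHitProb_succ_succ]
    simp only [← expectStep_const_mul]
    have : ∀ s : Finset ℕ, ∀ F : ℕ → ℕ × Fin d → ℝ≥0∞,
        ∑ n ∈ s, W.expectStep (F n) x = W.expectStep (fun z => ∑ n ∈ s, F n z) x := by
      intro s F
      simp only [← Finset.tsum_subtype, expectStep_tsum]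
    rw [this, ← expectStep_add]
    refine W.expectStep_mono (fun z => ?_) x
    unfold offLayer
    split_ifs with hz
    · simp
    · simpa using ih z

theorem hitProb_le_one (x : ℕ × Fin d) (y : ℕ) : W.hitProb x y ≤ 1 := by
  have h := W.mul_hitProb_le (u := fun _ => 1) (y := y) (c := 1)
    (fun x => by simp [expectStep_const]) x
  simpa using h

end HalfStripWalk

/-! ### Strictly substochastic matrices and casts to `ℝ≥0∞` -/

namespace Matrix

variable {ι : Type*} [Fintype ι]

/-- Minimum principle: at a minimiser `m`, `v m ≥ (K v) m ≥ (∑ j, K m j) * v m`, which is impossible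
for `v m < 0` as the row sum is below `1`. It yields both invertibility of `1 - K` and nonnegativity
of the inverse. -/
theorem nonneg_of_one_sub_mulVec_nonneg [DecidableEq ι] {K : Matrix ι ι ℝ}
    (hK : ∀ i j, 0 ≤ K i j) (hK1 : ∀ i, ∑ j, K i j < 1) {v : ι → ℝ}
    (hv : ∀ i, 0 ≤ ((1 - K) *ᵥ v) i) (i : ι) : 0 ≤ v i := by
  have : Nonempty ι := ⟨i⟩
  obtain ⟨m, hm⟩ := Finite.exists_min v
  refine le_trans ?_ (hm i)
  by_contra! hneg
  have h1 := hv m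
  rw [Matrix.sub_mulVec, Matrix.one_mulVec, Pi.sub_apply, sub_nonneg] at h1
  have h2 : (∑ j, K m j) * v m ≤ (K *ᵥ v) m := by
    rw [Finset.sum_mul]
    exact Finset.sum_le_sum fun j _ => mul_le_mul_of_nonneg_left (hm j) (hK m j)
  nlinarith [hK1 m]

theorem isUnit_one_sub_of_sum_row_lt_one [DecidableEq ι] {K : Matrix ι ι ℝ}
    (hK : ∀ i j, 0 ≤ K i j) (hK1 : ∀ i, ∑ j, K i j < 1) : IsUnit (1 - K) := by
  rw [← Matrix.mulVec_injective_iff_isUnit]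
  refine (injective_iff_map_eq_zero (Matrix.mulVecLin (1 - K))).2 fun v hv => ?_
  rw [Matrix.mulVecLin_apply] at hv
  funext i
  refine le_antisymm ?_ (nonneg_of_one_sub_mulVec_nonneg hK hK1 (by simp [hv]) i)
  have := nonneg_of_one_sub_mulVec_nonneg (v := -v) hK hK1 (by simp [Matrix.mulVec_neg, hv]) i
  simpa using this

theorem inv_one_sub_nonneg [DecidableEq ι] {K : Matrix ι ι ℝ}
    (hK : ∀ i j, 0 ≤ K i j) (hK1 : ∀ i, ∑ j, K i j < 1) (i j : ι) : 0 ≤ (1 - K)⁻¹ i j := by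
  have hu := (Matrix.isUnit_iff_isUnit_det _).1 (isUnit_one_sub_of_sum_row_lt_one hK hK1)
  have h : (1 - K) *ᵥ (fun i => (1 - K)⁻¹ i j) = fun i => (1 : Matrix ι ι ℝ) i j := by
    have h' := Matrix.mul_nonsing_inv _ hu
    funext k
    exact congrFun (congrFun h' k) j
  refine nonneg_of_one_sub_mulVec_nonneg (v := fun i => (1 - K)⁻¹ i j) hK hK1 (fun k => ?_) i
  rw [h]
  simp only [Matrix.one_apply]
  split_ifs <;> norm_num

theorem mul_apply_nonneg {A B : Matrix ι ι ℝ} (hA : ∀ i j, 0 ≤ A i j) (hB : ∀ i j, 0 ≤ B i j)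
    (i j : ι) : 0 ≤ (A * B) i j :=
  Finset.sum_nonneg fun k _ => mul_nonneg (hA i k) (hB k j)

theorem map_ofReal_mul {A B : Matrix ι ι ℝ} (hA : ∀ i j, 0 ≤ A i j) (hB : ∀ i j, 0 ≤ B i j) :
    (A * B).map ENNReal.ofReal = A.map ENNReal.ofReal * B.map ENNReal.ofReal := by
  ext i j
  simp only [Matrix.map_apply, Matrix.mul_apply]
  rw [ENNReal.ofReal_sum_of_nonneg fun k _ => mul_nonneg (hA i k) (hB k j)]
  exact Finset.sum_congr rfl fun k _ => ENNReal.ofReal_mul (hA i k)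

theorem map_ofReal_add {ι : Type*} {A B : Matrix ι ι ℝ} (hA : ∀ i j, 0 ≤ A i j) (hB : ∀ i j, 0 ≤ B i j) :
    (A + B).map ENNReal.ofReal = A.map ENNReal.ofReal + B.map ENNReal.ofReal := by
  ext i j
  exact ENNReal.ofReal_add (hA i j) (hB i j)

theorem map_ofReal_one {ι : Type*} [DecidableEq ι] :
    (1 : Matrix ι ι ℝ).map ENNReal.ofReal = 1 :=
  Matrix.map_one _ ENNReal.ofReal_zero ENNReal.ofReal_one

theorem ofReal_vecMul {v : ι → ℝ} {A : Matrix ι ι ℝ} (hv : ∀ i, 0 ≤ v i)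
    (hA : ∀ i j, 0 ≤ A i j) (j : ι) :
    ENNReal.ofReal ((v ᵥ* A) j) =
      ((fun i => ENNReal.ofReal (v i)) ᵥ* A.map ENNReal.ofReal) j := by
  simp only [Matrix.vecMul, dotProduct, Matrix.map_apply]
  rw [ENNReal.ofReal_sum_of_nonneg fun k _ => mul_nonneg (hv k) (hA k j)]
  exact Finset.sum_congr rfl fun k _ => ENNReal.ofReal_mul (hv k)

end Matrix

/-! ### Exit matrices: existence and signs -/

namespace HalfStripWalk

variable {d : ℕ} {W : HalfStripWalk d}

section Norm

attribute [local instance] Matrix.linftyOpNormedAddCommGroup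

theorem sum_row_lt_one_of_norm_lt_one {M : Matrix (Fin d) (Fin d) ℝ} (h : ‖M‖ < 1) (i : Fin d) :
    ∑ j, M i j < 1 := by
  refine lt_of_le_of_lt ?_ h
  rw [Matrix.linfty_opNorm_def]
  have h1 : (∑ j, ‖M i j‖₊ : NNReal) ≤ Finset.univ.sup fun i => ∑ j, ‖M i j‖₊ :=
    Finset.le_sup (f := fun i => ∑ j, ‖M i j‖₊) (Finset.mem_univ i)
  refine le_trans (Finset.sum_le_sum fun j _ => Real.le_norm_self (M i j)) ?_
  simpa only [NNReal.coe_sum, coe_nnnorm] using NNReal.coe_le_coe.2 h1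

theorem ConditionC.sum_R_add_Q_lt_one (hC : W.ConditionC) (n : ℕ) (i : Fin d) :
    ∑ j, (W.R (n + 1) + W.Q (n + 1)) i j < 1 :=
  sum_row_lt_one_of_norm_lt_one (hC.norm_down (n + 1) (by omega)) i

end Norm

variable (W) in
/-- The substochastic matrix `Q_{n+1} ζ_n⁺ + R_{n+1}` of returns to layer `n + 1` before the first
visit to layer `n + 2`. -/
noncomputable def returnMatrix (n : ℕ) : Matrix (Fin d) (Fin d) ℝ :=
  W.Q (n + 1) * W.zetaPlus n + W.R (n + 1)

theorem one_sub_returnMatrix (n : ℕ) :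
    1 - W.Q (n + 1) * W.zetaPlus n - W.R (n + 1) = 1 - W.returnMatrix n :=
  sub_sub _ _ _

theorem returnMatrix_nonneg {n : ℕ} (hz : ∀ i j, 0 ≤ W.zetaPlus n i j) (i j : Fin d) :
    0 ≤ W.returnMatrix n i j :=
  add_nonneg (Matrix.mul_apply_nonneg (W.Q_nonneg _ (by omega)) hz i j)
    (W.R_nonneg _ (by omega) i j)

theorem returnMatrix_mulVec_one {n : ℕ} (hz : W.zetaPlus n *ᵥ 1 = 1) :
    W.returnMatrix n *ᵥ 1 = (W.R (n + 1) + W.Q (n + 1)) *ᵥ 1 := by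
  rw [returnMatrix, Matrix.add_mulVec, ← Matrix.mulVec_mulVec, hz, Matrix.add_mulVec, add_comm]

theorem sum_returnMatrix_lt_one (hC : W.ConditionC) {n : ℕ} (hz : W.zetaPlus n *ᵥ 1 = 1)
    (i : Fin d) : ∑ j, W.returnMatrix n i j < 1 := by
  have h := congrFun (returnMatrix_mulVec_one hz) i
  simp only [Matrix.mulVec, dotProduct, Pi.one_apply, mul_one] at h
  rw [h]
  exact hC.sum_R_add_Q_lt_one n i

/-- Nonnegativity and stochasticity are proved together, because the inverse defining the next
matrix is controlled by the row sums of `R + Q`, which requires `ζ_n 1 = 1`. Stochasticity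
propagates since `P 1 = (1 - K) 1` for the return matrix `K`. -/
theorem zetaPlus_nonneg_and_stochastic (hC : W.ConditionC) (n : ℕ) :
    (∀ i j, 0 ≤ W.zetaPlus n i j) ∧ W.zetaPlus n *ᵥ 1 = 1 := by
  induction n with
  | zero => exact ⟨W.P_nonneg 0, W.P_zero_stochastic⟩
  | succ n ih =>
    have hK := returnMatrix_nonneg ih.1
    have hK1 := sum_returnMatrix_lt_one hC ih.2
    have hu := (Matrix.isUnit_iff_isUnit_det _).1 (Matrix.isUnit_one_sub_of_sum_row_lt_one hK hK1)
    rw [zetaPlus, one_sub_returnMatrix]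
    refine ⟨Matrix.mul_apply_nonneg (Matrix.inv_one_sub_nonneg hK hK1) (W.P_nonneg _), ?_⟩
    have h : W.P (n + 1) *ᵥ 1 = (1 - W.returnMatrix n) *ᵥ 1 := by
      have h1 := W.row_sum (n + 1) (by omega)
      rw [Matrix.sub_mulVec, returnMatrix_mulVec_one ih.2, Matrix.one_mulVec, eq_sub_iff_add_eq,
        ← Matrix.add_mulVec, ← add_assoc, add_right_comm, h1]
    rw [← Matrix.mulVec_mulVec, h, Matrix.mulVec_mulVec, Matrix.nonsing_inv_mul _ hu,
      Matrix.one_mulVec]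

theorem ConditionC.zetaPlus_nonneg (hC : W.ConditionC) (n : ℕ) (i j : Fin d) :
    0 ≤ W.zetaPlus n i j :=
  (zetaPlus_nonneg_and_stochastic hC n).1 i j

theorem ConditionC.returnMatrix_nonneg (hC : W.ConditionC) (n : ℕ) (i j : Fin d) :
    0 ≤ W.returnMatrix n i j :=
  HalfStripWalk.returnMatrix_nonneg (hC.zetaPlus_nonneg n) i j

theorem ConditionC.sum_returnMatrix_lt_one (hC : W.ConditionC) (n : ℕ) (i : Fin d) :
    ∑ j, W.returnMatrix n i j < 1 :=
  HalfStripWalk.sum_returnMatrix_lt_one hC (zetaPlus_nonneg_and_stochastic hC n).2 i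

theorem ConditionC.isUnit_one_sub_returnMatrix (hC : W.ConditionC) (n : ℕ) :
    IsUnit (1 - W.returnMatrix n) :=
  Matrix.isUnit_one_sub_of_sum_row_lt_one (hC.returnMatrix_nonneg n)
    (hC.sum_returnMatrix_lt_one n)

theorem ConditionC.inv_nonneg (hC : W.ConditionC) (n : ℕ) (i j : Fin d) :
    0 ≤ (1 - W.returnMatrix n)⁻¹ i j :=
  Matrix.inv_one_sub_nonneg (hC.returnMatrix_nonneg n) (hC.sum_returnMatrix_lt_one n) i j

theorem APlus_succ (n : ℕ) : W.APlus (n + 1) = (1 - W.returnMatrix n)⁻¹ * W.Q (n + 1) := by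
  rw [← one_sub_returnMatrix]; rfl

theorem zetaPlus_succ (n : ℕ) : W.zetaPlus (n + 1) = (1 - W.returnMatrix n)⁻¹ * W.P (n + 1) := by
  rw [← one_sub_returnMatrix]; rfl

theorem ConditionC.APlus_nonneg (hC : W.ConditionC) (n : ℕ) (i j : Fin d) :
    0 ≤ W.APlus (n + 1) i j := by
  rw [APlus_succ]
  exact Matrix.mul_apply_nonneg (hC.inv_nonneg n) (W.Q_nonneg _ (by omega)) i j

theorem ConditionC.APlusProd_nonneg (hC : W.ConditionC) (n : ℕ) (i j : Fin d) :
    0 ≤ W.APlusProd n i j := by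
  induction n generalizing i j with
  | zero =>
    simp only [APlusProd, Matrix.one_apply]
    split_ifs <;> norm_num
  | succ n ih => exact Matrix.mul_apply_nonneg (hC.APlus_nonneg n) ih i j

theorem ConditionC.muLayer_nonneg (hC : W.ConditionC) {μ : Fin d → ℝ} (hμ : ∀ i, 0 ≤ μ i)
    (n : ℕ) (i : Fin d) : 0 ≤ W.muLayer μ n i := by
  induction n generalizing i with
  | zero => exact hμ i
  | succ n ih => exact dotProduct_nonneg_of_nonneg ih fun k => hC.zetaPlus_nonneg n k i

theorem ConditionC.betaTerm_nonneg (hC : W.ConditionC) {μ : Fin d → ℝ} (hμ : ∀ i, 0 ≤ μ i)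
    (k : ℕ) : 0 ≤ W.betaTerm μ k := by
  exact dotProduct_nonneg_of_nonneg (fun j => dotProduct_nonneg_of_nonneg (hC.muLayer_nonneg hμ k)
    fun i => hC.APlusProd_nonneg k i j) zero_le_one

/-- The matrix of expected numbers of visits to layer `n + 1` before the first visit to layer
`n + 2`, and its relations to the return matrix, over `ℝ≥0∞`. -/
theorem ConditionC.exists_green (hC : W.ConditionC) (n : ℕ) :
    ∃ U : Matrix (Fin d) (Fin d) ℝ≥0∞, (∀ i j, U i j ≠ ⊤) ∧
      U = 1 + U * (W.returnMatrix n).map ENNReal.ofReal ∧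
      U = 1 + (W.returnMatrix n).map ENNReal.ofReal * U ∧
      (W.zetaPlus (n + 1)).map ENNReal.ofReal = U * (W.P (n + 1)).map ENNReal.ofReal ∧
      (W.APlus (n + 1)).map ENNReal.ofReal = U * (W.Q (n + 1)).map ENNReal.ofReal := by
  have hU := hC.inv_nonneg n
  have hK := hC.returnMatrix_nonneg n
  have hu := (Matrix.isUnit_iff_isUnit_det _).1 (hC.isUnit_one_sub_returnMatrix n)
  have h1 : ∀ i j, 0 ≤ (1 : Matrix (Fin d) (Fin d) ℝ) i j := fun i j => by
    simp only [Matrix.one_apply]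
    split_ifs <;> norm_num
  -- Subtraction is truncated in `ℝ≥0∞`, so being an inverse is recorded as two fixed-point
  -- identities: `U = 1 + K U` serves `visits_layer_succ`, and `U = 1 + U K` serves `visits_le`.
  refine ⟨(1 - W.returnMatrix n)⁻¹.map ENNReal.ofReal, fun i j => ENNReal.ofReal_ne_top,
    ?_, ?_, ?_, ?_⟩
  · rw [← Matrix.map_ofReal_mul hU hK, ← Matrix.map_ofReal_one,
      ← Matrix.map_ofReal_add h1 (Matrix.mul_apply_nonneg hU hK)]
    congr 1
    rw [← sub_eq_iff_eq_add]
    have h := Matrix.nonsing_inv_mul _ hu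
    rwa [mul_sub, mul_one] at h
  · rw [← Matrix.map_ofReal_mul hK hU, ← Matrix.map_ofReal_one,
      ← Matrix.map_ofReal_add h1 (Matrix.mul_apply_nonneg hK hU)]
    congr 1
    rw [← sub_eq_iff_eq_add]
    have h := Matrix.mul_nonsing_inv _ hu
    rwa [sub_mul, one_mul] at h
  · rw [zetaPlus_succ, Matrix.map_ofReal_mul hU (W.P_nonneg _)]
  · rw [APlus_succ, Matrix.map_ofReal_mul hU (W.Q_nonneg _ (by omega))]

end HalfStripWalk

/-! ### Expected visits to layer `0` -/

namespace HalfStripWalk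

variable {d : ℕ} {W : HalfStripWalk d}

variable (W) in
/-- `visitTerm n k i` is the expected number of visits to layer `0`, for the walk started at
`(n, i)`, between the first visits to the layers `n + k` and `n + k + 1`. -/
noncomputable def visitTerm : ℕ → ℕ → Fin d → ℝ≥0∞
  | n, 0 => (W.APlusProd n).map ENNReal.ofReal *ᵥ 1
  | n, k + 1 => (W.zetaPlus n).map ENNReal.ofReal *ᵥ visitTerm (n + 1) k

theorem ConditionC.visitTerm_succ_zero (hC : W.ConditionC) (n : ℕ) :
    W.visitTerm (n + 1) 0 = (W.APlus (n + 1)).map ENNReal.ofReal *ᵥ W.visitTerm n 0 := by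
  simp only [visitTerm, APlusProd]
  rw [Matrix.map_ofReal_mul (hC.APlus_nonneg n) (hC.APlusProd_nonneg n), Matrix.mulVec_mulVec]

variable (W) in
theorem visitTerm_zero_zero : W.visitTerm 0 0 = 1 := by
  simp only [visitTerm, APlusProd]
  rw [Matrix.map_ofReal_one, Matrix.one_mulVec]

variable (W) in
/-- The expected total number of visits to layer `0`. -/
noncomputable def visits (x : ℕ × Fin d) : ℝ≥0∞ :=
  ∑' k, W.visitTerm x.1 k x.2

/-- The values of a function on the sites of layer `n`. -/
def layerValues (g : ℕ × Fin d → ℝ≥0∞) (n : ℕ) (i : Fin d) : ℝ≥0∞ := g (n, i)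

variable (W) in
theorem visits_eq (n : ℕ) :
    layerValues W.visits n = W.visitTerm n 0 +
      (W.zetaPlus n).map ENNReal.ofReal *ᵥ layerValues W.visits (n + 1) := by
  funext i
  simp only [layerValues, visits, Pi.add_apply]
  rw [tsum_eq_zero_add' ENNReal.summable]
  congr 1
  simp only [visitTerm, Matrix.mulVec, dotProduct]
  rw [Summable.tsum_finsetSum (fun _ _ => ENNReal.summable)]
  simp only [layerValues, visits, ENNReal.tsum_mul_left]

theorem expectStep_layer_zero (f : ℕ × Fin d → ℝ≥0∞) (i : Fin d) :
    W.expectStep f (0, i) = ((W.P 0).map ENNReal.ofReal *ᵥ layerValues f 1) i :=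
  W.expectStep_zero f i

theorem expectStep_layer_succ (f : ℕ × Fin d → ℝ≥0∞) (n : ℕ) (i : Fin d) :
    W.expectStep f (n + 1, i) =
      ((W.P (n + 1)).map ENNReal.ofReal *ᵥ layerValues f (n + 2) +
        ((W.R (n + 1)).map ENNReal.ofReal *ᵥ layerValues f (n + 1) +
          (W.Q (n + 1)).map ENNReal.ofReal *ᵥ layerValues f n)) i :=
  W.expectStep_succ f n i

theorem ConditionC.map_returnMatrix (hC : W.ConditionC) (n : ℕ) :
    (W.returnMatrix n).map ENNReal.ofReal =
      (W.Q (n + 1)).map ENNReal.ofReal * (W.zetaPlus n).map ENNReal.ofReal +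
        (W.R (n + 1)).map ENNReal.ofReal := by
  have hQ := W.Q_nonneg (n + 1) (by omega)
  rw [returnMatrix, Matrix.map_ofReal_add (Matrix.mul_apply_nonneg hQ (hC.zetaPlus_nonneg n))
    (W.R_nonneg _ (by omega)), Matrix.map_ofReal_mul hQ (hC.zetaPlus_nonneg n)]

theorem visits_layer_zero (i : Fin d) :
    W.visits (0, i) = 1 + W.expectStep W.visits (0, i) := by
  rw [expectStep_layer_zero]
  have h := congrFun (W.visits_eq 0) i
  rw [visitTerm_zero_zero] at h
  exact h

/-- With `g` the layer values of `visits`, the Green matrix gives `g (n+1) = U w = w + K g (n+1)`.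
Expanding `K = Q ζ_n + R` and recombining by `visits_eq n` leaves the one-step equation. -/
theorem ConditionC.visits_layer_succ (hC : W.ConditionC) (n : ℕ) (i : Fin d) :
    W.visits (n + 1, i) = W.expectStep W.visits (n + 1, i) := by
  obtain ⟨U, -, -, hU, hz, hA⟩ := hC.exists_green n
  set g := layerValues W.visits
  set w := (W.P (n + 1)).map ENNReal.ofReal *ᵥ g (n + 2) +
    (W.Q (n + 1)).map ENNReal.ofReal *ᵥ W.visitTerm n 0 with hw
  have h1 : g (n + 1) = U *ᵥ w := by
    rw [hw, Matrix.mulVec_add, Matrix.mulVec_mulVec, Matrix.mulVec_mulVec, ← hz, ← hA,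
      ← hC.visitTerm_succ_zero, add_comm ((W.zetaPlus (n + 1)).map ENNReal.ofReal *ᵥ _)]
    exact W.visits_eq (n + 1)
  have h2 : g (n + 1) = w + (W.returnMatrix n).map ENNReal.ofReal *ᵥ g (n + 1) := by
    conv_lhs => rw [h1, hU, Matrix.add_mulVec, Matrix.one_mulVec, ← Matrix.mulVec_mulVec, ← h1]
  have h3 : g n = W.visitTerm n 0 + (W.zetaPlus n).map ENNReal.ofReal *ᵥ g (n + 1) :=
    W.visits_eq n
  rw [expectStep_layer_succ]
  change g (n + 1) i = _
  refine congrFun ?_ i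
  change g (n + 1) = (W.P (n + 1)).map ENNReal.ofReal *ᵥ g (n + 2) +
    ((W.R (n + 1)).map ENNReal.ofReal *ᵥ g (n + 1) + (W.Q (n + 1)).map ENNReal.ofReal *ᵥ g n)
  conv_lhs => rw [h2]
  rw [h3, hw, hC.map_returnMatrix, Matrix.add_mulVec, Matrix.mulVec_add, Matrix.mulVec_mulVec]
  abel

/-- If layer `0` is recurrent, then it is visited infinitely often in expectation. -/
theorem ConditionC.visits_eq_top (hC : W.ConditionC) (h0 : W.LayerRecurrent 0) (i : Fin d) :
    W.visits (0, i) = ⊤ := by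
  set c := ⨅ j, W.visits (0, j) with hc
  have hle : ∀ j, c ≤ W.visits (0, j) := fun j => iInf_le _ j
  have hstep : ∀ z : ℕ × Fin d, (if z.1 = 0 then c else W.expectStep W.visits z) ≤ W.visits z := by
    rintro ⟨n, j⟩
    cases n with
    | zero => simpa using hle j
    | succ n => simpa using (hC.visits_layer_succ n j).ge
  -- The comparison function is `expectStep visits`, not `visits`: this keeps the extra `1` on layer
  -- `0` for the final inequality.
  have hge : ∀ j, 1 + c ≤ W.visits (0, j) := fun j => by
    have h := W.mul_hitProb_le (u := W.expectStep W.visits) (y := 0) (c := c)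
      (fun x => W.expectStep_mono hstep x) (0, j)
    rw [h0 j, mul_one] at h
    rw [visits_layer_zero]
    gcongr
  have h1 : 1 + c ≤ c := le_iInf hge
  have h2 : c = ⊤ := by
    by_contra hne
    have := ENNReal.le_of_add_le_add_right hne (h1.trans (zero_add c).ge)
    simp at this
  exact top_le_iff.1 (h2 ▸ hle i)

/-- The function `visits` is bounded by every finite superharmonic function whose defect on
layer `0` is at least one. -/
theorem ConditionC.visits_le (hC : W.ConditionC) {u : ℕ × Fin d → ℝ≥0∞} (hu : ∀ z, u z ≠ ⊤)
    (h : ∀ z, W.expectStep u z ≤ u z) (h0 : ∀ i, 1 + W.expectStep u (0, i) ≤ u (0, i))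
    (z : ℕ × Fin d) : W.visits z ≤ u z := by
  -- The identity `visits_eq` as an inequality for `u`, proved by induction up the layers.
  have key : ∀ n, W.visitTerm n 0 + (W.zetaPlus n).map ENNReal.ofReal *ᵥ layerValues u (n + 1) ≤
      layerValues u n := by
    intro n
    induction n with
    | zero =>
      intro i
      rw [visitTerm_zero_zero]
      refine le_trans (le_of_eq ?_) (h0 i)
      rw [expectStep_layer_zero]
      rfl
    | succ n ih =>
      obtain ⟨U, hUtop, hU, -, hz, hA⟩ := hC.exists_green n
      set g := layerValues u
      set K := (W.returnMatrix n).map ENNReal.ofReal with hK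
      set w := (W.P (n + 1)).map ENNReal.ofReal *ᵥ g (n + 2) +
        (W.Q (n + 1)).map ENNReal.ofReal *ᵥ W.visitTerm n 0 with hw
      have hmono : ∀ (M : Matrix (Fin d) (Fin d) ℝ≥0∞) {a b : Fin d → ℝ≥0∞}, a ≤ b →
          M *ᵥ a ≤ M *ᵥ b := fun M a b hab i =>
        Finset.sum_le_sum (fun j _ => mul_le_mul_right (hab j) (M i j) :
          ∀ j ∈ Finset.univ, M i j * a j ≤ M i j * b j)
      have hfin : ∀ (M : Matrix (Fin d) (Fin d) ℝ≥0∞) (a : Fin d → ℝ≥0∞), (∀ i j, M i j ≠ ⊤) →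
          (∀ j, a j ≠ ⊤) → ∀ i, (M *ᵥ a) i ≠ ⊤ := fun M a hM ha i => by
        rw [Matrix.mulVec, dotProduct]
        exact ENNReal.sum_ne_top.2 fun j _ => ENNReal.mul_ne_top (hM i j) (ha j)
      have h1 : w + K *ᵥ g (n + 1) ≤ g (n + 1) := by
        have h2 : (W.P (n + 1)).map ENNReal.ofReal *ᵥ g (n + 2) +
            ((W.R (n + 1)).map ENNReal.ofReal *ᵥ g (n + 1) +
              (W.Q (n + 1)).map ENNReal.ofReal *ᵥ g n) ≤ g (n + 1) := fun i => by
          have := h (n + 1, i)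
          rwa [expectStep_layer_succ] at this
        refine le_trans ?_ h2
        refine le_trans (le_of_eq ?_) (add_le_add_right (add_le_add_right (hmono _ ih) _) _)
        rw [hw, hK, hC.map_returnMatrix, Matrix.add_mulVec, Matrix.mulVec_add,
          Matrix.mulVec_mulVec]
        abel
      -- Applying `U` to `w + K g ≤ g` and using `U g = g + U K g`, the term `U K g` cancels because
      -- `U`, `K` and `u` are finite.
      have h3 : U *ᵥ w ≤ g (n + 1) := by
        intro i
        have h4 := hmono U h1 i
        have h5 : U *ᵥ g (n + 1) = g (n + 1) + U *ᵥ (K *ᵥ g (n + 1)) := by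
          conv_lhs => rw [hU, Matrix.add_mulVec, Matrix.one_mulVec, ← Matrix.mulVec_mulVec]
        rw [h5, Matrix.mulVec_add] at h4
        exact ENNReal.le_of_add_le_add_right
          (hfin U _ hUtop (hfin K _ (fun i j => ENNReal.ofReal_ne_top) fun j => hu _) i) h4
      refine le_trans (le_of_eq ?_) h3
      rw [hw, Matrix.mulVec_add, Matrix.mulVec_mulVec, Matrix.mulVec_mulVec, ← hz, ← hA,
        ← hC.visitTerm_succ_zero, add_comm (W.visitTerm (n + 1) 0)]
  -- Iterating `key` from layer to layer produces the successive terms of the series.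
  have hsum : ∀ N n i, ∑ k ∈ Finset.range N, W.visitTerm n k i ≤ u (n, i) := by
    intro N
    induction N with
    | zero => simp
    | succ N ih =>
      intro n i
      refine le_trans ?_ (key n i)
      rw [Finset.sum_range_succ', add_comm, Pi.add_apply]
      gcongr
      simp only [visitTerm, Matrix.mulVec, dotProduct]
      rw [Finset.sum_comm]
      refine Finset.sum_le_sum fun j _ => ?_
      rw [← Finset.mul_sum]
      gcongr
      exact ih (n + 1) j
  exact ENNReal.tsum_le_of_sum_range_le fun N => hsum N z.1 z.2

/-! ### Potentials when some layer is not recurrent -/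

variable (W) in
/-- There is a bounded superharmonic function which is not harmonic at `x`. -/
def HasPotential (x : ℕ × Fin d) : Prop :=
  ∃ u e : ℕ × Fin d → ℝ≥0∞, ∃ C : ℝ≥0∞, C ≠ ⊤ ∧ (∀ z, u z ≤ C) ∧
    (∀ z, e z + W.expectStep u z ≤ u z) ∧ e x ≠ 0

/-- Replace the pair `(u, e)` by its one-step expectations: the bound and the inequality survive,
and the new defect at `x` is at least `W.trans x y` times the old one at `y`. -/
theorem HasPotential.of_trans_pos {x y : ℕ × Fin d} (hxy : 0 < W.trans x y)
    (h : W.HasPotential y) : W.HasPotential x := by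
  obtain ⟨u, e, C, hC, huC, hu, he⟩ := h
  refine ⟨W.expectStep u, W.expectStep e, C, hC, fun z => ?_, fun z => ?_, ?_⟩
  · exact (W.expectStep_mono huC z).trans (W.expectStep_const C z).le
  · rw [← expectStep_add]
    exact W.expectStep_mono hu z
  · have h1 : ENNReal.ofReal (W.trans x y) * e y ≤ W.expectStep e x :=
      ENNReal.le_tsum (f := fun z => ENNReal.ofReal (W.trans x z) * e z) y
    exact (lt_of_lt_of_le (ENNReal.mul_pos (ENNReal.ofReal_pos.2 hxy).ne' he) h1).ne'

/-- The potential is the probability of hitting the layer of `x` at a time `≥ 0`; its defect on that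
layer is the probability of never returning. -/
theorem HasPotential.of_hitProb_ne_one {x : ℕ × Fin d} (hx : W.hitProb x x.1 ≠ 1) :
    W.HasPotential x := by
  refine ⟨fun z => if z.1 = x.1 then 1 else W.hitProb z x.1,
    fun z => if z.1 = x.1 then 1 - W.hitProb z x.1 else 0, 1, ENNReal.one_ne_top, fun z => ?_,
    fun z => ?_, ?_⟩
  · dsimp only
    split_ifs
    exacts [le_rfl, W.hitProb_le_one z x.1]
  · rw [← hitProb_eq_expectStep]
    dsimp only
    split_ifs
    · rw [tsub_add_cancel_of_le (W.hitProb_le_one z x.1)]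
    · rw [zero_add]
  · simpa [tsub_eq_zero_iff_le] using lt_of_le_of_ne (W.hitProb_le_one x x.1) hx

theorem ConditionC.reachable (hC : W.ConditionC) (i : Fin d) (y : ℕ × Fin d) :
    Relation.ReflTransGen (fun x y => 0 < W.trans x y) (0, i) y := by
  obtain ⟨n, j⟩ := y
  induction n generalizing j with
  | zero => exact hC.layer_zero_communicates i j
  | succ n ih =>
    obtain ⟨k, -, hk⟩ := Finset.exists_lt_of_sum_lt
      (show ∑ _k : Fin d, (0 : ℝ) < ∑ k, W.P n k j by simpa using hC.col_P n j)
    refine (ih k).tail ?_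
    cases n <;> simpa [trans] using hk

theorem ConditionC.hasPotential_layer_zero (hC : W.ConditionC) {y : ℕ × Fin d}
    (hy : W.HasPotential y) (i : Fin d) : W.HasPotential (0, i) := by
  have h := hC.reachable i y
  generalize ((0, i) : ℕ × Fin d) = x at h ⊢
  induction h using Relation.ReflTransGen.head_induction_on with
  | refl => exact hy
  | head hxy _ ih => exact ih.of_trans_pos hxy

theorem ConditionC.visits_ne_top (hC : W.ConditionC) (h : ¬ W.Recurrent) (z : ℕ × Fin d) :
    W.visits z ≠ ⊤ := by
  have hpot : ∀ i, W.HasPotential (0, i) := by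
    simp only [Recurrent, LayerRecurrent, not_forall] at h
    obtain ⟨y, j, hj⟩ := h
    exact hC.hasPotential_layer_zero (HasPotential.of_hitProb_ne_one (x := (y, j)) hj)
  choose u e C hCtop huC hue he using hpot
  have hetop : ∀ i, e i (0, i) ≠ ⊤ := fun i =>
    ne_top_of_le_ne_top (hCtop i) ((le_self_add.trans (hue i _)).trans (huC i _))
  -- Each summand is scaled to have defect exactly `1` at its own site `(0, i)`; the sum is over
  -- `Fin d`, so `v` stays finite.
  set v : ℕ × Fin d → ℝ≥0∞ := fun z => ∑' i, (e i (0, i))⁻¹ * u i z with hv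
  have hstep : ∀ z, W.expectStep v z = ∑' i, (e i (0, i))⁻¹ * W.expectStep (u i) z := fun z => by
    rw [hv, expectStep_tsum]
    simp only [expectStep_const_mul]
  have hdefect : ∀ z, (∑' i, (e i (0, i))⁻¹ * e i z) + W.expectStep v z ≤ v z := fun z => by
    rw [hstep, ← ENNReal.tsum_add]
    refine ENNReal.tsum_le_tsum fun i => ?_
    rw [← mul_add]
    exact mul_le_mul_right (hue i z) _
  have hvtop : ∀ z, v z ≠ ⊤ := fun z => by
    simp only [hv, tsum_fintype]
    exact ENNReal.sum_ne_top.2 fun i _ => ENNReal.mul_ne_top (ENNReal.inv_ne_top.2 (he i))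
      (ne_top_of_le_ne_top (hCtop i) (huC i z))
  refine ne_top_of_le_ne_top (hvtop z) (hC.visits_le hvtop
    (fun z => le_add_self.trans (hdefect z)) (fun i => ?_) z)
  refine le_trans (add_le_add_left ?_ _) (hdefect (0, i))
  refine le_trans (le_of_eq ?_) (ENNReal.le_tsum (f := fun j => (e j (0, j))⁻¹ * e j (0, i)) i)
  exact (ENNReal.inv_mul_cancel (he i) (hetop i)).symm

/-! ### Identification of `betaPlus` and conclusion -/

theorem ConditionC.ofReal_betaTerm (hC : W.ConditionC) {μ : Fin d → ℝ} (hμ : ∀ i, 0 ≤ μ i)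
    (k : ℕ) : ENNReal.ofReal (W.betaTerm μ k) =
      (fun i => ENNReal.ofReal (μ i)) ⬝ᵥ W.visitTerm 0 k := by
  -- The first `k` exit matrices move across the pairing, from the column vector to `μ`; `l` must
  -- vary in the induction.
  have key : ∀ l k, (fun i => ENNReal.ofReal (W.muLayer μ k i)) ⬝ᵥ W.visitTerm k l =
      (fun i => ENNReal.ofReal (μ i)) ⬝ᵥ W.visitTerm 0 (k + l) := by
    intro l k
    induction k generalizing l with
    | zero => rw [zero_add]; rfl
    | succ k ih =>
      have h1 : (fun i => ENNReal.ofReal (W.muLayer μ (k + 1) i)) =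
          (fun i => ENNReal.ofReal (W.muLayer μ k i)) ᵥ* (W.zetaPlus k).map ENNReal.ofReal :=
        funext fun i => Matrix.ofReal_vecMul (hC.muLayer_nonneg hμ k) (hC.zetaPlus_nonneg k) i
      rw [h1, ← Matrix.dotProduct_mulVec, add_right_comm, add_assoc, ← ih (l + 1)]
      rfl
  rw [← add_zero k, ← key 0 k, add_zero, visitTerm, Matrix.dotProduct_mulVec]
  simp only [betaTerm, dotProduct, Pi.one_apply, mul_one]
  rw [ENNReal.ofReal_sum_of_nonneg (f := W.muLayer μ k ᵥ* W.APlusProd k) fun j _ =>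
    dotProduct_nonneg_of_nonneg (hC.muLayer_nonneg hμ k) fun i => hC.APlusProd_nonneg k i j]
  exact Finset.sum_congr rfl fun j _ =>
    Matrix.ofReal_vecMul (hC.muLayer_nonneg hμ k) (hC.APlusProd_nonneg k) j

theorem ConditionC.betaPlus_eq (hC : W.ConditionC) {μ : Fin d → ℝ} (hμ : ∀ i, 0 ≤ μ i) :
    W.betaPlus μ = ∑ i, ENNReal.ofReal (μ i) * W.visits (0, i) := by
  simp only [betaPlus, hC.ofReal_betaTerm hμ, dotProduct, visits]
  rw [Summable.tsum_finsetSum (fun _ _ => ENNReal.summable)]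
  simp only [ENNReal.tsum_mul_left]

end HalfStripWalk

/-- The first two conjuncts say that the quantities in the third one are well defined: the inverse
matrices exist and the series defining `β⁺` has nonnegative terms. -/
theorem theorem1 {d : ℕ} (hd : 1 ≤ d) (W : HalfStripWalk d) (hC : W.ConditionC)
    (μ : Fin d → ℝ) (hμ : μ ∈ stdSimplex ℝ (Fin d)) :
    (∀ n, 1 ≤ n → IsUnit (1 - W.Q n * W.zetaPlus (n - 1) - W.R n)) ∧
    (∀ k, 0 ≤ W.betaTerm μ k) ∧
    (W.Recurrent ↔ W.betaPlus μ = ⊤) := by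
  refine ⟨fun n hn => ?_, hC.betaTerm_nonneg hμ.1, fun h => ?_, fun h => ?_⟩
  · obtain ⟨m, rfl⟩ := Nat.exists_eq_add_of_le' hn
    rw [Nat.add_sub_cancel, HalfStripWalk.one_sub_returnMatrix]
    exact hC.isUnit_one_sub_returnMatrix m
  · obtain ⟨i, -, hi⟩ := Finset.exists_lt_of_sum_lt
      (show ∑ _i : Fin d, (0 : ℝ) < ∑ i, μ i by simp [hμ.2])
    rw [hC.betaPlus_eq hμ.1, ENNReal.sum_eq_top]
    refine ⟨i, Finset.mem_univ i, ?_⟩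
    rw [hC.visits_eq_top (h 0) i]
    exact ENNReal.mul_top (ENNReal.ofReal_pos.2 hi).ne'
  · by_contra hrec
    rw [hC.betaPlus_eq hμ.1] at h
    exact ENNReal.sum_ne_top.2 (fun i _ => ENNReal.mul_ne_top ENNReal.ofReal_ne_top
      (hC.visits_ne_top hrec _)) h
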